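/- Let $\theta:\mathbb R^m\to\,]-\infty,\infty]$ be convex piecewise linear (CPWL), given by vectors $a_1,\dots,a_l,d_1,\dots,d_p\in\mathbb R^m$ and numbers $\alpha_1,\dots,\alpha_l,\beta_1,\dots,\beta_p$ ($l\ge 1$): $\operatorname{dom}\theta:=\{z:\theta(z)<\infty\}=\{z:\langle d_i,z\rangle\le\beta_i\ \text{for all } i\}$ and $\theta(z)=\max_{i}\{\langle a_i,z\rangle-\alpha_i\}$ for $z\in\operatorname{dom}\theta$. For $z\in\operatorname{dom}\theta$ let $K(z)$ be the set of $i$ with $\langle a_j,z\rangle-\alpha_j\le\langle a_i,z\rangle-\alpha_i$ for all $j$, and $I(z)=\{i:\langle d_i,z\rangle=\beta_i\}$. For $\Omega\subset\mathbb R^k$ and $x\in\Omega$, the limiting normal cone $N(x;\Omega)$ is the set of all limits $v=\lim v_k$ for which there are $x_k\to x$ in $\Omega$ with $\limsup_{y\to x_k,\,y\in\Omega}\langle v_k,y-x_k\rangle/\|y-x_k\|\le 0$ for every $k$. For $\varphi:\mathbb R^k\to\,]-\infty,\infty]$ and $x\in\operatorname{dom}\varphi$ put $\partial\varphi(x)=\{v:(v,-1)\in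 N((x,\varphi(x));\operatorname{epi}\varphi)\}$ and $\partial^\infty\varphi(x)=\{v:(v,0)\in N((x,\varphi(x));\operatorname{epi}\varphi)\}$; both sets are empty for $x\notin\operatorname{dom}\varphi$. For $v\in\partial\varphi(x)$ the second-order subdifferential is $\partial^2\varphi(x,v)(u)=\{y:(y,-u)\in N((x,v);\operatorname{gph}\partial\varphi)\}$. Let $\Phi:\mathbb R^n\times\mathbb R^d\to\mathbb R^m$ be $C^2$ around $(\bar x,\bar w)$, let $\bar z:=\Phi(\bar x,\bar w)\in\operatorname{dom}\theta$, and suppose that $\partial^\infty\theta(\bar z)\cap\ker\nabla_x\Phi(\bar x,\bar w)^*=\{0\}$ (that is, $\psi:=\theta\circ\Phi$ is fully amenable in $x$ at $\bar x$ with compatible parametrization by $w$ at $\bar w$). Let $S(\bar z)$ be the subspace parallel to the affine hull of $\partial\theta(\bar z)$, and let $\partial_x\psi(\bar x,\bar w)$ denote the subdifferential of $\psi(\cdot,\bar w)$ at $\bar x$. Then: (i) For every $\bar v\in\partial\theta(\bar z)$, $$\partial^2\theta(\bar z,\bar v)(0)=\operatorname{span}\{a_i-a_j: i,j\in K(\bar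 z)\}+\operatorname{span}\{d_i: i\in I(\bar z)\}.$$ (ii) For every $\bar v\in\partial\theta(\bar z)$, $\partial^2\theta(\bar z,\bar v)(0)=S(\bar z)$. (iii) For every $\bar q\in\partial_x\psi(\bar x,\bar w)$, the second-order qualification condition (SOQC) $$\partial^2\theta(\bar z,v)(0)\cap\ker\nabla_x\Phi(\bar x,\bar w)^*=\{0\}\quad\text{for all } v\in\partial\theta(\bar z)\text{ with }\nabla_x\Phi(\bar x,\bar w)^*v=\bar q$$ holds if and only if $$S(\bar z)\cap\ker\nabla_x\Phi(\bar x,\bar w)^*=\{0\}.$$ Moreover, for every single $\bar v\in\partial\theta(\bar z)$ the condition $\partial^2\theta(\bar z,\bar v)(0)\cap\ker\nabla_x\Phi(\bar x,\bar w)^*=\{0\}$ is equivalent to the latter one. -/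

import Mathlib

open Filter Topology

noncomputable section

namespace VarAnalysis

section FirstOrder

variable {E : Type*} [NormedAddCommGroup E] [InnerProductSpace ℝ E]
variable {G : Type*} [NormedAddCommGroup G] [InnerProductSpace ℝ G]

/-- The prenormal (regular, Fréchet) cone: `v` with
`limsup ⟪v, y - x⟫ / ‖y - x‖ ≤ 0` as `y → x` within `Ω`, written without division. -/
def regularNormalCone (Ω : Set E) (x : E) : Set E :=
  {v | ∀ ε : ℝ, 0 < ε → ∀ᶠ y in 𝓝[Ω] x, inner ℝ v (y - x) ≤ ε * ‖y - x‖}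

/-- The limiting (basic, Mordukhovich) normal cone to `Ω` at a point `x` of `Ω`
(empty if `x ∉ Ω`). -/
def normalCone (Ω : Set E) (x : E) : Set E :=
  {v | x ∈ Ω ∧ ∃ xs vs : ℕ → E, Tendsto xs atTop (𝓝 x) ∧ Tendsto vs atTop (𝓝 v) ∧
    ∀ k, xs k ∈ Ω ∧ vs k ∈ regularNormalCone Ω (xs k)}

/-- The effective domain of a function with values in `]-∞, ∞]`. -/
def effDom (φ : E → WithTop ℝ) : Set E := {x | φ x < ⊤}

/-- The epigraph, a subset of the Hilbert space product of `E` and `ℝ`. -/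
def epi (φ : E → WithTop ℝ) : Set (WithLp 2 (E × ℝ)) :=
  {p | φ p.fst ≤ (p.snd : WithTop ℝ)}

/-- The (limiting) subdifferential; it is empty outside of the domain. -/
def subdifferential (φ : E → WithTop ℝ) (x : E) : Set E :=
  {v | ∃ r : ℝ, φ x = (r : WithTop ℝ) ∧
    WithLp.toLp 2 (v, (-1 : ℝ)) ∈ normalCone (epi φ) (WithLp.toLp 2 (x, r))}

/-- The (limiting) singular subdifferential; it is empty outside of the domain. -/
def singularSubdifferential (φ : E → WithTop ℝ) (x : E) : Set E :=
  {v | ∃ r : ℝ, φ x = (r : WithTop ℝ) ∧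
    WithLp.toLp 2 (v, (0 : ℝ)) ∈ normalCone (epi φ) (WithLp.toLp 2 (x, r))}

/-- The graph of a set-valued mapping, in the Hilbert space product. -/
def gph (F : E → Set G) : Set (WithLp 2 (E × G)) := {p | p.snd ∈ F p.fst}

/-- The coderivative `D*F(x, y)(u)`. -/
def coderivative (F : E → Set G) (x : E) (y : G) (u : G) : Set E :=
  {v | WithLp.toLp 2 (v, -u) ∈ normalCone (gph F) (WithLp.toLp 2 (x, y))}

/-- The second-order subdifferential `∂²φ(x, v)(u) = (D*∂φ)(x, v)(u)`. -/
def secondSubdifferential (φ : E → WithTop ℝ) (x v u : E) : Set E :=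
  coderivative (subdifferential φ) x v u

/-- The subspace `S(z)` parallel to the affine hull of the subdifferential at `z`. -/
def parallelSubspace (φ : E → WithTop ℝ) (z : E) : Submodule ℝ E :=
  (affineSpan ℝ (subdifferential φ z)).direction

end FirstOrder

section PiecewiseLinear

variable {E : Type*} [NormedAddCommGroup E] [InnerProductSpace ℝ E] {l p : ℕ}

/-- `θ` is given by the data `(a, α, d, β)`: its domain is the polyhedron
`{z | ⟪d i, z⟫ ≤ β i for all i}` (the whole space if `p = 0`), on which `θ` is the maximum of the
`l ≥ 1` affine functions `⟪a i, z⟫ - α i`. -/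
def IsCPWLRepr [NeZero l] (θ : E → WithTop ℝ) (a : Fin l → E) (α : Fin l → ℝ)
    (d : Fin p → E) (β : Fin p → ℝ) : Prop :=
  effDom θ = {z | ∀ i, inner ℝ (d i) z ≤ β i} ∧
  ∀ z ∈ effDom θ, θ z =
    ((Finset.univ.sup' Finset.univ_nonempty (fun i => inner ℝ (a i) z - α i) : ℝ) : WithTop ℝ)

/-- Convex piecewise linear extended-real-valued functions. -/
def IsCPWL (θ : E → WithTop ℝ) : Prop :=
  ∃ (l p : ℕ) (_ : NeZero l) (a : Fin l → E) (α : Fin l → ℝ) (d : Fin p → E) (β : Fin p → ℝ),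
    IsCPWLRepr θ a α d β

/-- The sets `C i`, on which the `i`-th affine function is maximal. -/
def pieceSet (θ : E → WithTop ℝ) (a : Fin l → E) (α : Fin l → ℝ) (i : Fin l) : Set E :=
  {z | z ∈ effDom θ ∧ ∀ j, inner ℝ (a j) z - α j ≤ inner ℝ (a i) z - α i}

/-- The active indices `K(z)` of the affine functions. -/
def activeK (θ : E → WithTop ℝ) (a : Fin l → E) (α : Fin l → ℝ) (z : E) : Set (Fin l) :=
  {i | z ∈ pieceSet θ a α i}

/-- The active indices `I(z)` of the constraints describing the domain. -/
def activeI (d : Fin p → E) (β : Fin p → ℝ) (z : E) : Set (Fin p) :=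
  {i | inner ℝ (d i) z = β i}

end PiecewiseLinear

section Composition

variable {n d m : ℕ}

/-- The kernel of the adjoint `∇ₓΦ(x, w)*` of the partial derivative of `Φ` in `x`. -/
def kerAdjoint
    (Φ : EuclideanSpace ℝ (Fin n) × EuclideanSpace ℝ (Fin d) → EuclideanSpace ℝ (Fin m))
    (x : EuclideanSpace ℝ (Fin n)) (w : EuclideanSpace ℝ (Fin d)) :
    Set (EuclideanSpace ℝ (Fin m)) :=
  {v | (fderiv ℝ (fun x' => Φ (x', w)) x).adjoint v = 0}

/-- `θ ∘ Φ`, with `θ` convex piecewise linear, is fully amenable in `x` at the given point, with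
compatible parametrization by `w`. -/
structure IsFullyAmenable (θ : EuclideanSpace ℝ (Fin m) → WithTop ℝ)
    (Φ : EuclideanSpace ℝ (Fin n) × EuclideanSpace ℝ (Fin d) → EuclideanSpace ℝ (Fin m))
    (x : EuclideanSpace ℝ (Fin n)) (w : EuclideanSpace ℝ (Fin d)) : Prop where
  cpwl : IsCPWL θ
  smooth : ContDiffAt ℝ 2 Φ (x, w)
  mem_dom : Φ (x, w) ∈ effDom θ
  qualification : singularSubdifferential θ (Φ (x, w)) ∩ kerAdjoint Φ x w = {0}

/-- The partial subdifferential `∂ₓψ(x, w)` in the first variable: the subdifferential of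
`ψ(·, w)` at `x`. -/
def partialSubdifferential
    (ψ : EuclideanSpace ℝ (Fin n) × EuclideanSpace ℝ (Fin d) → WithTop ℝ)
    (x : EuclideanSpace ℝ (Fin n)) (w : EuclideanSpace ℝ (Fin d)) :
    Set (EuclideanSpace ℝ (Fin n)) :=
  subdifferential (fun x' => ψ (x', w)) x

/-- The set `M(x, w, q)` of multipliers `v ∈ ∂θ(Φ(x, w))` with `∇ₓΦ(x, w)* v = q`. -/
def multipliers (θ : EuclideanSpace ℝ (Fin m) → WithTop ℝ)
    (Φ : EuclideanSpace ℝ (Fin n) × EuclideanSpace ℝ (Fin d) → EuclideanSpace ℝ (Fin m))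
    (x : EuclideanSpace ℝ (Fin n)) (w : EuclideanSpace ℝ (Fin d))
    (q : EuclideanSpace ℝ (Fin n)) : Set (EuclideanSpace ℝ (Fin m)) :=
  {v | v ∈ subdifferential θ (Φ (x, w)) ∧
    (fderiv ℝ (fun x' => Φ (x', w)) x).adjoint v = q}

/-- The second-order qualification condition for `θ ∘ Φ` in `x` at `(x, w)`, relative to a
partial subgradient `q`. -/
def SOQC (θ : EuclideanSpace ℝ (Fin m) → WithTop ℝ)
    (Φ : EuclideanSpace ℝ (Fin n) × EuclideanSpace ℝ (Fin d) → EuclideanSpace ℝ (Fin m))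
    (x : EuclideanSpace ℝ (Fin n)) (w : EuclideanSpace ℝ (Fin d))
    (q : EuclideanSpace ℝ (Fin n)) : Prop :=
  ∀ v ∈ multipliers θ Φ x w q,
    secondSubdifferential θ (Φ (x, w)) v 0 ∩ kerAdjoint Φ x w = {0}

end Composition

end VarAnalysis

end

/-! Let `L` be the span in (i), which is `activeSpan` at `z`, and let `S` be the subspace parallel
to the affine hull of the subdifferential at `z`. Parts (i) and (ii) follow from the cycle
`∂²θ(z,v)(0) ⊆ L ⊆ S ⊆ ∂²θ(z,v)(0)`.

The first inclusion (`secondSubdifferential_zero_subset`) is dual: for `g ⟂ L`, at every graph point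
near `(z, v)` the function is affine along `±g`, so subgradients persist and the graph contains
short segments in the directions `(±g, 0)`. Hence limiting normals `(y, 0)` satisfy `y ⟂ g`. The
second (`activeSpan_le_parallelSubspace`) exhibits `a i` and `a i + d j` as subgradients. The third
(`IsCPWLRepr.parallelSubspace_subset_secondSubdifferential`) approximates `v` by relative interior
points `u` of the subdifferential at `z`; there `(y, 0)` is already a regular normal at `(z, u)` for
each `y ∈ S`, because nearby subgradients can be shifted by a small multiple of `y`.

For (iii), (ii) makes the condition independent of the multiplier, so only the existence of a
multiplier remains. This is the first-order chain rule `multipliers_nonempty`, obtained by viewing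
the epigraph of the composition as a preimage of the epigraph of `θ`. Penalization gives approximate
multipliers, and the qualification condition keeps them bounded. -/

namespace VarAnalysis

/-! ### Normal cones, in particular to convex sets. -/

section NormalCones

variable {E : Type*} [NormedAddCommGroup E] [InnerProductSpace ℝ E]

/-- Regular normals are nonpositive on directions along which one can move inside the set. -/
theorem inner_nonpos_of_mem_regularNormalCone {Ω : Set E} {x v h : E}
    (hv : v ∈ regularNormalCone Ω x) (hh : ∀ᶠ t : ℝ in 𝓝[>] 0, x + t • h ∈ Ω) :
    inner ℝ v h ≤ 0 := by
  refine le_of_forall_pos_le_add fun ε hε => ?_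
  have hη : 0 < ε / (‖h‖ + 1) := by positivity
  have hlim : Tendsto (fun t : ℝ => x + t • h) (𝓝[>] 0) (𝓝[Ω] x) := by
    refine tendsto_nhdsWithin_iff.2 ⟨?_, hh⟩
    have : Tendsto (fun t : ℝ => x + t • h) (𝓝 0) (𝓝 (x + (0 : ℝ) • h)) := by
      apply Continuous.tendsto; fun_prop
    simpa using this.mono_left nhdsWithin_le_nhds
  obtain ⟨t, ht, ht0⟩ :=
    ((hlim.eventually (hv _ hη)).and (eventually_mem_nhdsWithin (a := (0 : ℝ)))).exists
  have ht0 : 0 < t := ht0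
  simp only [add_sub_cancel_left, inner_smul_right, norm_smul, Real.norm_eq_abs,
    abs_of_pos ht0] at ht
  have h1 : inner ℝ v h ≤ ε / (‖h‖ + 1) * ‖h‖ := by
    refine le_of_mul_le_mul_left ?_ ht0
    linarith [ht]
  have h2 : ε / (‖h‖ + 1) * ‖h‖ ≤ ε := by
    rw [div_mul_eq_mul_div, div_le_iff₀ (by positivity)]
    nlinarith [norm_nonneg h]
  linarith

theorem mem_regularNormalCone_of_inner_nonpos {Ω : Set E} {x v : E}
    (h : ∀ᶠ y in 𝓝[Ω] x, inner ℝ v (y - x) ≤ 0) : v ∈ regularNormalCone Ω x := by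
  intro ε hε
  filter_upwards [h] with y hy
  exact hy.trans (by positivity)

theorem mem_normalCone_of_mem_regularNormalCone {Ω : Set E} {x v : E} (hx : x ∈ Ω)
    (hv : v ∈ regularNormalCone Ω x) : v ∈ normalCone Ω x :=
  ⟨hx, fun _ => x, fun _ => v, tendsto_const_nhds, tendsto_const_nhds, fun _ => ⟨hx, hv⟩⟩

theorem inner_nonpos_of_convex_of_mem_regularNormalCone {C : Set E} (hC : Convex ℝ C) {x v y : E}
    (hx : x ∈ C) (hv : v ∈ regularNormalCone C x) (hy : y ∈ C) : inner ℝ v (y - x) ≤ 0 := by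
  refine inner_nonpos_of_mem_regularNormalCone hv ?_
  filter_upwards [Ioc_mem_nhdsGT (zero_lt_one' ℝ)] with t ht
  exact hC.add_smul_sub_mem hx hy ⟨ht.1.le, ht.2⟩

/-- On a convex set the inequality for regular normals is global, and a global inequality survives
limits. -/
theorem mem_normalCone_iff_of_convex {C : Set E} (hC : Convex ℝ C) {x v : E} :
    v ∈ normalCone C x ↔ x ∈ C ∧ ∀ y ∈ C, inner ℝ v (y - x) ≤ 0 := by
  constructor
  · rintro ⟨hx, xs, vs, hxs, hvs, h⟩
    refine ⟨hx, fun y hy => ?_⟩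
    exact le_of_tendsto' (hvs.inner (tendsto_const_nhds.sub hxs))
      fun k => inner_nonpos_of_convex_of_mem_regularNormalCone hC (h k).1 (h k).2 hy
  · rintro ⟨hx, h⟩
    refine mem_normalCone_of_mem_regularNormalCone hx (mem_regularNormalCone_of_inner_nonpos ?_)
    filter_upwards [eventually_mem_nhdsWithin] with y hy using h y hy

/-- A nonempty convex set contains a ball of its affine span. -/
theorem _root_.Convex.exists_ball_direction_subset [FiniteDimensional ℝ E] {C : Set E}
    (hC : Convex ℝ C) (hne : C.Nonempty) :
    ∃ c ∈ C, ∃ r > 0, ∀ s ∈ (affineSpan ℝ C).direction, ‖s‖ < r → c + s ∈ C := by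
  obtain ⟨c, hc⟩ := hne.intrinsicInterior hC
  obtain ⟨c', hc', rfl⟩ := mem_intrinsicInterior.1 hc
  obtain ⟨r, hr, hball⟩ := Metric.mem_nhds_iff.1 (mem_interior_iff_mem_nhds.1 hc')
  refine ⟨c', intrinsicInterior_subset hc, r, hr, fun s hs hsr => ?_⟩
  have hmem : (c' : E) + s ∈ affineSpan ℝ C := by
    rw [add_comm]
    exact AffineSubspace.vadd_mem_of_mem_direction hs c'.2
  refine hball (a := ⟨_, hmem⟩) ?_
  rw [Metric.mem_ball, Subtype.dist_eq]
  simpa using hsr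

end NormalCones

/-! ### Convex piecewise linear functions and their second-order subdifferential at zero. -/

section PiecewiseLinear

variable {E : Type*} [NormedAddCommGroup E] [InnerProductSpace ℝ E] {l p : ℕ}

variable {θ : E → WithTop ℝ} {a : Fin l → E} {α : Fin l → ℝ} {d : Fin p → E} {β : Fin p → ℝ}

/-- The span of the differences of the active `a i` and of the active `d i`. -/
def activeSpan (θ : E → WithTop ℝ) (a : Fin l → E) (α : Fin l → ℝ)
    (d : Fin p → E) (β : Fin p → ℝ) (z : E) : Submodule ℝ E :=
  Submodule.span ℝ {y | ∃ i ∈ activeK θ a α z, ∃ j ∈ activeK θ a α z, y = a i - a j} ⊔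
    Submodule.span ℝ {y | ∃ i ∈ activeI d β z, y = d i}

/-- These are the directions along which all active pieces grow at the same rate and all active
constraints stay tight. -/
theorem mem_activeSpan_orthogonal {z h : E} :
    h ∈ (activeSpan θ a α d β z)ᗮ ↔
      (∀ i ∈ activeK θ a α z, ∀ j ∈ activeK θ a α z, inner ℝ (a i) h = inner ℝ (a j) h) ∧
        ∀ i ∈ activeI d β z, inner ℝ (d i) h = 0 := by
  rw [activeSpan, ← Submodule.inf_orthogonal, Submodule.mem_inf,
    Submodule.mem_orthogonal, Submodule.mem_orthogonal]
  constructor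
  · rintro ⟨h1, h2⟩
    refine ⟨fun i hi j hj => ?_, fun i hi => h2 _ (Submodule.subset_span ⟨i, hi, rfl⟩)⟩
    rw [← sub_eq_zero, ← inner_sub_left]
    exact h1 _ (Submodule.subset_span ⟨i, hi, j, hj, rfl⟩)
  · rintro ⟨h1, h2⟩
    constructor
    · intro u hu
      induction hu using Submodule.span_induction with
      | mem u hu =>
        obtain ⟨i, hi, j, hj, rfl⟩ := hu
        rw [inner_sub_left, h1 i hi j hj, sub_self]
      | zero => simp
      | add u v _ _ hu hv => rw [inner_add_left, hu, hv, add_zero]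
      | smul c u _ hu => rw [inner_smul_left, hu, mul_zero]
    · intro u hu
      induction hu using Submodule.span_induction with
      | mem u hu =>
        obtain ⟨i, hi, rfl⟩ := hu
        exact h2 i hi
      | zero => simp
      | add u v _ _ hu hv => rw [inner_add_left, hu, hv, add_zero]
      | smul c u _ hu => rw [inner_smul_left, hu, mul_zero]

variable [NeZero l]

/-- The polyhedron of all `z` with `⟪d i, z⟫ ≤ β i` for all `i`. -/
def polyhedron (d : Fin p → E) (β : Fin p → ℝ) : Set E := {z | ∀ i, inner ℝ (d i) z ≤ β i}

/-- The maximum of the affine functions `⟪a i, z⟫ - α i`. -/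
def maxAffine (a : Fin l → E) (α : Fin l → ℝ) (z : E) : ℝ :=
  Finset.univ.sup' Finset.univ_nonempty (fun i => inner ℝ (a i) z - α i)

theorem le_maxAffine (a : Fin l → E) (α : Fin l → ℝ) (z : E) (i : Fin l) :
    inner ℝ (a i) z - α i ≤ maxAffine a α z :=
  Finset.le_sup' (fun i => inner ℝ (a i) z - α i) (Finset.mem_univ i)

theorem maxAffine_le {z : E} {r : ℝ} (h : ∀ i, inner ℝ (a i) z - α i ≤ r) :
    maxAffine a α z ≤ r :=
  Finset.sup'_le _ _ fun i _ => h i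

theorem continuous_maxAffine (a : Fin l → E) (α : Fin l → ℝ) : Continuous (maxAffine a α) :=
  Continuous.finset_sup'_apply _ fun i _ => by fun_prop

theorem convex_polyhedron (d : Fin p → E) (β : Fin p → ℝ) : Convex ℝ (polyhedron d β) := by
  intro x hx y hy s t hs ht hst i
  rw [inner_add_right, inner_smul_right, inner_smul_right]
  calc _ ≤ s * β i + t * β i := by gcongr <;> [exact hx i; exact hy i]
    _ = β i := by rw [← add_mul, hst, one_mul]

theorem isClosed_polyhedron (d : Fin p → E) (β : Fin p → ℝ) : IsClosed (polyhedron d β) := by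
  simp only [polyhedron, Set.ofPred_forall]
  exact isClosed_iInter fun i => isClosed_le (by fun_prop) continuous_const

theorem maxAffine_combo_le (x y : E) {s t : ℝ} (hs : 0 ≤ s) (ht : 0 ≤ t) (hst : s + t = 1) :
    maxAffine a α (s • x + t • y) ≤ s * maxAffine a α x + t * maxAffine a α y := by
  refine maxAffine_le fun i => ?_
  rw [inner_add_right, inner_smul_right, inner_smul_right]
  calc _ = s * (inner ℝ (a i) x - α i) + t * (inner ℝ (a i) y - α i) := by
          linear_combination -(α i) * hst.symm
    _ ≤ _ := by gcongr <;> exact le_maxAffine _ _ _ i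

namespace IsCPWLRepr

theorem mem_effDom (hθ : IsCPWLRepr θ a α d β) {z : E} :
    z ∈ effDom θ ↔ z ∈ polyhedron d β := by
  rw [hθ.1]; rfl

theorem apply_eq (hθ : IsCPWLRepr θ a α d β) {z : E} (hz : z ∈ polyhedron d β) :
    θ z = (maxAffine a α z : WithTop ℝ) :=
  hθ.2 z (hθ.mem_effDom.2 hz)

theorem mem_epi (hθ : IsCPWLRepr θ a α d β) {q : WithLp 2 (E × ℝ)} :
    q ∈ epi θ ↔ q.fst ∈ polyhedron d β ∧ maxAffine a α q.fst ≤ q.snd := by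
  constructor
  · intro h
    have hq : q.fst ∈ polyhedron d β :=
      hθ.mem_effDom.1 (lt_of_le_of_lt (show θ q.fst ≤ _ from h) (WithTop.coe_lt_top _))
    refine ⟨hq, WithTop.coe_le_coe.1 ?_⟩
    rw [← hθ.apply_eq hq]
    exact h
  · rintro ⟨h, h'⟩
    change θ q.fst ≤ _
    rw [hθ.apply_eq h]
    exact WithTop.coe_le_coe.2 h'

theorem convex_epi (hθ : IsCPWLRepr θ a α d β) : Convex ℝ (epi θ) := by
  intro x hx y hy s t hs ht hst
  rw [hθ.mem_epi] at hx hy ⊢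
  refine ⟨convex_polyhedron d β hx.1 hy.1 hs ht hst, ?_⟩
  refine (maxAffine_combo_le x.fst y.fst hs ht hst).trans ?_
  change _ ≤ s * x.snd + t * y.snd
  gcongr
  exacts [hx.2, hy.2]

theorem isClosed_epi (hθ : IsCPWLRepr θ a α d β) : IsClosed (epi θ) := by
  have : epi θ = {q | q.fst ∈ polyhedron d β} ∩ {q | maxAffine a α q.fst ≤ q.snd} :=
    Set.ext fun q => hθ.mem_epi
  rw [this]
  refine ((isClosed_polyhedron d β).preimage (by fun_prop)).inter (isClosed_le ?_ (by fun_prop))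
  exact (continuous_maxAffine a α).comp (by fun_prop)

/-- The limiting subdifferential of a CPWL function consists of its convex subgradients. -/
theorem mem_subdifferential (hθ : IsCPWLRepr θ a α d β) {z v : E} :
    v ∈ subdifferential θ z ↔ z ∈ polyhedron d β ∧
      ∀ y ∈ polyhedron d β, maxAffine a α z + inner ℝ v (y - z) ≤ maxAffine a α y := by
  constructor
  · rintro ⟨r, hr, h⟩
    rw [mem_normalCone_iff_of_convex hθ.convex_epi] at h
    obtain ⟨h1, h2⟩ := h
    have hz : z ∈ polyhedron d β := (hθ.mem_epi.1 h1).1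
    have hr' : maxAffine a α z = r := WithTop.coe_injective ((hθ.apply_eq hz).symm.trans hr)
    refine ⟨hz, fun y hy => ?_⟩
    have := h2 (WithLp.toLp 2 (y, maxAffine a α y)) (hθ.mem_epi.2 ⟨hy, le_rfl⟩)
    simp [WithLp.prod_inner_apply] at this
    linarith
  · rintro ⟨hz, h⟩
    refine ⟨_, hθ.apply_eq hz, ?_⟩
    rw [mem_normalCone_iff_of_convex hθ.convex_epi]
    refine ⟨hθ.mem_epi.2 ⟨hz, le_rfl⟩, fun y hy => ?_⟩
    rw [hθ.mem_epi] at hy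
    have := h _ hy.1
    simp [WithLp.prod_inner_apply]
    linarith [hy.2]

theorem convex_subdifferential (hθ : IsCPWLRepr θ a α d β) (z : E) :
    Convex ℝ (subdifferential θ z) := by
  intro v hv v' hv' s t hs ht hst
  rw [hθ.mem_subdifferential] at *
  refine ⟨hv.1, fun y hy => ?_⟩
  rw [inner_add_left, inner_smul_left, inner_smul_left]
  have h1 := mul_le_mul_of_nonneg_left (hv.2 y hy) hs
  have h2 := mul_le_mul_of_nonneg_left (hv'.2 y hy) ht
  obtain rfl : s = 1 - t := by linarith
  simp only [conj_trivial]
  linarith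

theorem mem_activeK (hθ : IsCPWLRepr θ a α d β) {z : E} (hz : z ∈ polyhedron d β) {i : Fin l} :
    i ∈ activeK θ a α z ↔ maxAffine a α z = inner ℝ (a i) z - α i := by
  constructor
  · intro h
    exact le_antisymm (maxAffine_le h.2) (le_maxAffine a α z i)
  · intro h
    exact ⟨hθ.mem_effDom.2 hz, fun j => h ▸ le_maxAffine a α z j⟩

theorem activeK_nonempty (hθ : IsCPWLRepr θ a α d β) {z : E} (hz : z ∈ polyhedron d β) :
    (activeK θ a α z).Nonempty := by
  obtain ⟨i, -, hi⟩ := Finset.exists_mem_eq_sup' (Finset.univ_nonempty (α := Fin l))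
    (fun i => inner ℝ (a i) z - α i)
  exact ⟨i, (hθ.mem_activeK hz).2 hi⟩

/-- The inactive affine pieces and constraints at a point remain inactive nearby. -/
theorem eventually_active_subset (hθ : IsCPWLRepr θ a α d β) {z : E} (hz : z ∈ polyhedron d β) :
    ∀ᶠ y in 𝓝 z, (∀ i, inner ℝ (d i) y = β i → inner ℝ (d i) z = β i) ∧
      (∀ i, inner ℝ (d i) z ≠ β i → inner ℝ (d i) y < β i) ∧
      ∀ i ∉ activeK θ a α z, ∀ j ∈ activeK θ a α z,
        inner ℝ (a i) y - α i < inner ℝ (a j) y - α j := by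
  have h1 : ∀ᶠ y in 𝓝 z, ∀ i, inner ℝ (d i) z ≠ β i → inner ℝ (d i) y < β i := by
    refine eventually_all.2 fun i => ?_
    by_cases hi : inner ℝ (d i) z = β i
    · simp [hi]
    · have : ∀ᶠ y in 𝓝 z, inner ℝ (d i) y < β i :=
        (Continuous.tendsto (by fun_prop) z).eventually_lt_const (lt_of_le_of_ne (hz i) hi)
      exact this.mono fun y hy _ => hy
  have h2 : ∀ᶠ y in 𝓝 z, ∀ i, i ∉ activeK θ a α z → ∀ j, j ∈ activeK θ a α z →
        inner ℝ (a i) y - α i < inner ℝ (a j) y - α j := by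
    refine eventually_all.2 fun i => ?_
    rw [eventually_imp_distrib_left]
    refine fun hi => eventually_all.2 fun j => ?_
    rw [eventually_imp_distrib_left]
    intro hj
    have hlt : inner ℝ (a i) z - α i < inner ℝ (a j) z - α j := by
      rw [hθ.mem_activeK hz] at hi hj
      exact lt_of_le_of_ne (hj ▸ le_maxAffine a α z i) fun h => hi (hj.trans h.symm)
    exact Tendsto.eventually_lt (Continuous.tendsto (by fun_prop) z)
      (Continuous.tendsto (by fun_prop) z) hlt
  filter_upwards [h1, h2] with y hy1 hy2
  exact ⟨fun i hi => by_contra fun h => (hy1 i h).ne hi, hy1, hy2⟩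

/-- Strict inequalities persist nearby. Consequently directions orthogonal to `activeSpan` at `z`
are orthogonal to it at all nearby points. -/
theorem eventually_activeK_subset (hθ : IsCPWLRepr θ a α d β) {z : E}
    (hz : z ∈ polyhedron d β) :
    ∀ᶠ y in 𝓝 z, activeK θ a α y ⊆ activeK θ a α z ∧ activeI d β y ⊆ activeI d β z := by
  filter_upwards [hθ.eventually_active_subset hz] with y hy
  refine ⟨fun i hi => by_contra fun h => ?_, fun i hi => hy.1 i hi⟩
  obtain ⟨j, hj⟩ := hθ.activeK_nonempty hz
  exact absurd (hi.2 j) (not_le.2 (hy.2.2 i h j hj))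

/-- The function is affine near `z` along directions orthogonal to `activeSpan`. -/
theorem eventually_affine (hθ : IsCPWLRepr θ a α d β) {z h : E} (hz : z ∈ polyhedron d β)
    (hh : h ∈ (activeSpan θ a α d β z)ᗮ) {i : Fin l} (hi : i ∈ activeK θ a α z) :
    ∀ᶠ t : ℝ in 𝓝 0, z + t • h ∈ polyhedron d β ∧
      maxAffine a α (z + t • h) = maxAffine a α z + t * inner ℝ (a i) h := by
  rw [mem_activeSpan_orthogonal] at hh
  have hlim : Tendsto (fun t : ℝ => z + t • h) (𝓝 0) (𝓝 z) := by
    have : Tendsto (fun t : ℝ => z + t • h) (𝓝 0) (𝓝 (z + (0 : ℝ) • h)) := by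
      apply Continuous.tendsto; fun_prop
    simpa using this
  filter_upwards [hlim.eventually (hθ.eventually_active_subset hz)] with t ht
  refine ⟨fun j => ?_, ?_⟩
  · by_cases hj : inner ℝ (d j) z = β j
    · rw [inner_add_right, inner_smul_right, hh.2 j hj, hj]; simp
    · exact (ht.2.1 j hj).le
  · have hi' := (hθ.mem_activeK hz).1 hi
    have hval : inner ℝ (a i) (z + t • h) - α i = maxAffine a α z + t * inner ℝ (a i) h := by
      rw [hi', inner_add_right, inner_smul_right]; ring
    refine le_antisymm (maxAffine_le fun j => ?_) (hval ▸ le_maxAffine a α _ i)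
    rw [← hval]
    by_cases hj : j ∈ activeK θ a α z
    · have hj' := (hθ.mem_activeK hz).1 hj
      rw [inner_add_right, inner_add_right, inner_smul_right, inner_smul_right,
        hh.1 j hj i hi]
      linarith
    · exact (ht.2.2 j hj i hi).le

theorem inner_eq_of_mem_orthogonal (hθ : IsCPWLRepr θ a α d β) {z h v : E}
    (hv : v ∈ subdifferential θ z)
    (hh : h ∈ (activeSpan θ a α d β z)ᗮ) {i : Fin l} (hi : i ∈ activeK θ a α z) :
    inner ℝ v h = inner ℝ (a i) h := by
  rw [hθ.mem_subdifferential] at hv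
  -- One inequality suffices, since the orthogonal complement is symmetric: apply it to `h` and
  -- `-h`.
  have key : ∀ h ∈ (activeSpan θ a α d β z)ᗮ, inner ℝ v h ≤ inner ℝ (a i) h := by
    intro h hh
    obtain ⟨t, ht, ht0⟩ := (((hθ.eventually_affine hv.1 hh hi).filter_mono
      (nhdsWithin_le_nhds (s := Set.Ioi 0))).and eventually_mem_nhdsWithin).exists
    have h1 := hv.2 _ ht.1
    rw [ht.2, add_sub_cancel_left, inner_smul_right] at h1
    exact le_of_mul_le_mul_left (by linarith) (show (0 : ℝ) < t from ht0)
  refine le_antisymm (key h hh) ?_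
  have := key (-h) (neg_mem hh)
  rw [inner_neg_right, inner_neg_right] at this
  linarith

/-- Subgradients persist along directions orthogonal to `activeSpan`. -/
theorem eventually_mem_subdifferential (hθ : IsCPWLRepr θ a α d β) {z h v : E}
    (hv : v ∈ subdifferential θ z) (hh : h ∈ (activeSpan θ a α d β z)ᗮ) :
    ∀ᶠ t : ℝ in 𝓝 0, v ∈ subdifferential θ (z + t • h) := by
  have hv' := hθ.mem_subdifferential.1 hv
  obtain ⟨i, hi⟩ := hθ.activeK_nonempty hv'.1
  filter_upwards [hθ.eventually_affine hv'.1 hh hi] with t ht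
  refine hθ.mem_subdifferential.2 ⟨ht.1, fun y hy => ?_⟩
  have := hv'.2 y hy
  rw [ht.2, ← hθ.inner_eq_of_mem_orthogonal hv hh hi, ← sub_sub, inner_sub_right _ (y - z),
    inner_smul_right]
  linarith

/-- Near `z`, all subgradients are subgradients at `z`, and the function is affine along them. -/
theorem eventually_subdifferential_subset (hθ : IsCPWLRepr θ a α d β) {z : E}
    (hz : z ∈ polyhedron d β) :
    ∀ᶠ y in 𝓝 z, ∀ v ∈ subdifferential θ y, v ∈ subdifferential θ z ∧
      maxAffine a α y = maxAffine a α z + inner ℝ v (y - z) := by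
  filter_upwards [hθ.eventually_activeK_subset hz] with y hy v hv
  have hv' := hθ.mem_subdifferential.1 hv
  obtain ⟨i, hi⟩ := hθ.activeK_nonempty hv'.1
  -- Indices active at `y` are active at `z` too, so the differences of active pieces and the slacks
  -- of active constraints vanish at both points.
  have horth : y - z ∈ (activeSpan θ a α d β y)ᗮ := by
    rw [mem_activeSpan_orthogonal]
    constructor
    · intro j hj k hk
      have h1 := (hθ.mem_activeK hv'.1).1 hj
      have h2 := (hθ.mem_activeK hv'.1).1 hk
      have h3 := (hθ.mem_activeK hz).1 (hy.1 hj)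
      have h4 := (hθ.mem_activeK hz).1 (hy.1 hk)
      rw [inner_sub_right, inner_sub_right]
      linarith
    · intro j hj
      have h1 : inner ℝ (d j) y = β j := hj
      have h2 : inner ℝ (d j) z = β j := hy.2 hj
      rw [inner_sub_right, h1, h2, sub_self]
  have heq : maxAffine a α y = maxAffine a α z + inner ℝ v (y - z) := by
    rw [hθ.inner_eq_of_mem_orthogonal hv horth hi, (hθ.mem_activeK hv'.1).1 hi,
      (hθ.mem_activeK hz).1 (hy.1 hi), inner_sub_right]
    ring
  refine ⟨hθ.mem_subdifferential.2 ⟨hz, fun u hu => ?_⟩, heq⟩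
  have h1 := hv'.2 u hu
  rw [heq] at h1
  have h2 : inner ℝ v (u - z) = inner ℝ v (y - z) + inner ℝ v (u - y) := by
    rw [← inner_add_right]; congr 1; abel
  linarith

theorem activeSpan_le_parallelSubspace (hθ : IsCPWLRepr θ a α d β) {z : E}
    (hz : z ∈ polyhedron d β) : activeSpan θ a α d β z ≤ parallelSubspace θ z := by
  have hmem : ∀ i ∈ activeK θ a α z, a i ∈ subdifferential θ z := by
    intro i hi
    refine hθ.mem_subdifferential.2 ⟨hz, fun y hy => ?_⟩
    rw [(hθ.mem_activeK hz).1 hi, inner_sub_right]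
    linarith [le_maxAffine a α y i]
  have hdir : ∀ u ∈ subdifferential θ z, ∀ v ∈ subdifferential θ z,
      u - v ∈ parallelSubspace θ z := fun u hu v hv =>
    AffineSubspace.vsub_mem_direction (subset_affineSpan ℝ _ hu) (subset_affineSpan ℝ _ hv)
  refine sup_le (Submodule.span_le.2 ?_) (Submodule.span_le.2 ?_)
  · rintro _ ⟨i, hi, j, hj, rfl⟩
    exact hdir _ (hmem i hi) _ (hmem j hj)
  · rintro _ ⟨j, hj, rfl⟩
    obtain ⟨i, hi⟩ := hθ.activeK_nonempty hz
    -- An active `d j` is normal to the domain at `z`, so adding it to a subgradient gives a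
    -- subgradient.
    have hadd : a i + d j ∈ subdifferential θ z := by
      refine hθ.mem_subdifferential.2 ⟨hz, fun y hy => ?_⟩
      have h1 := (hθ.mem_subdifferential.1 (hmem i hi)).2 y hy
      have h2 : inner ℝ (d j) z = β j := hj
      have h3 := hy j
      rw [inner_add_left, inner_sub_right (d j)]
      linarith
    simpa using hdir _ hadd _ (hmem i hi)

/-- Regular normals at nearby graph points are tested against `(g, 0)`, with `g` orthogonal to
`activeSpan`; in finite dimension the double orthogonal complement gives the subspace back. -/
theorem secondSubdifferential_zero_subset [FiniteDimensional ℝ E] (hθ : IsCPWLRepr θ a α d β)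
    {z v : E} : secondSubdifferential θ z v 0 ⊆ (activeSpan θ a α d β z : Set E) := by
  rintro y ⟨hzv, xs, vs, hxs, hvs, h⟩
  have hz : z ∈ polyhedron d β := (hθ.mem_subdifferential.1 hzv).1
  rw [SetLike.mem_coe, ← Submodule.orthogonal_orthogonal (activeSpan θ a α d β z)]
  have key : ∀ g ∈ (activeSpan θ a α d β z)ᗮ, inner ℝ y g ≤ 0 := by
    intro g hg
    have h1 : Tendsto (fun k => (xs k).fst) atTop (𝓝 z) :=
      (WithLp.continuous_fst 2 E E |>.tendsto _).comp hxs
    have h2 : Tendsto (fun k => (vs k).fst) atTop (𝓝 y) :=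
      (WithLp.continuous_fst 2 E E |>.tendsto _).comp hvs
    refine le_of_tendsto (h2.inner (tendsto_const_nhds (x := g))) ?_
    filter_upwards [h1.eventually (hθ.eventually_activeK_subset hz)] with k hk
    have hg' : g ∈ (activeSpan θ a α d β (xs k).fst)ᗮ := by
      rw [mem_activeSpan_orthogonal] at hg ⊢
      exact ⟨fun i hi j hj => hg.1 i (hk.1 hi) j (hk.1 hj), fun i hi => hg.2 i (hk.2 hi)⟩
    have := inner_nonpos_of_mem_regularNormalCone (h := WithLp.toLp 2 (g, (0 : E))) (h k).2 ?_
    · simpa [WithLp.prod_inner_apply] using this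
    · refine ((hθ.eventually_mem_subdifferential (h k).1 hg').filter_mono
        nhdsWithin_le_nhds).mono fun t ht => ?_
      change (xs k).snd + t • (0 : E) ∈ subdifferential θ ((xs k).fst + t • g)
      simpa using ht
  rw [Submodule.mem_orthogonal']
  intro g hg
  refine le_antisymm (key g hg) ?_
  have := key (-g) (neg_mem hg)
  rw [inner_neg_right] at this
  linarith

end IsCPWLRepr

theorem IsCPWLRepr.parallelSubspace_subset_secondSubdifferential [FiniteDimensional ℝ E]
    (hθ : IsCPWLRepr θ a α d β) {z v : E} (hv : v ∈ subdifferential θ z) :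
    (parallelSubspace θ z : Set E) ⊆ secondSubdifferential θ z v 0 := by
  intro y hy
  have hz := (hθ.mem_subdifferential.1 hv).1
  obtain ⟨c, hc, r, hr, hball⟩ :=
    (hθ.convex_subdifferential z).exists_ball_direction_subset ⟨v, hv⟩
  set t : ℕ → ℝ := fun k => 1 / ((k : ℝ) + 1) with ht
  have ht0 : ∀ k, 0 < t k := fun k => by positivity
  have ht1 : ∀ k, t k ≤ 1 := fun k => by
    rw [ht]; exact div_le_one_of_le₀ (by simp) (by positivity)
  have htlim : Tendsto t atTop (𝓝 0) := tendsto_one_div_add_atTop_nhds_zero_nat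
  -- Moving from `v` towards the relative interior point `c` shrinks the relative ball around `c` to
  -- radius `t k * r` around `u k`.
  set u : ℕ → E := fun k => v + t k • (c - v) with hu
  have hball' : ∀ k, ∀ s ∈ parallelSubspace θ z, ‖s‖ < t k * r →
      u k + s ∈ subdifferential θ z := by
    intro k s hs hsr
    have h1 : c + (t k)⁻¹ • s ∈ subdifferential θ z := by
      refine hball _ (Submodule.smul_mem _ _ hs) ?_
      rw [norm_smul, Real.norm_eq_abs, abs_of_pos (inv_pos.2 (ht0 k)), inv_mul_lt_iff₀ (ht0 k)]
      exact hsr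
    have h2 := (hθ.convex_subdifferential z).add_smul_sub_mem hv h1 ⟨(ht0 k).le, ht1 k⟩
    convert h2 using 1
    rw [hu, add_sub_right_comm, smul_add, smul_smul, mul_inv_cancel₀ (ht0 k).ne', one_smul,
      add_assoc]
  have huk : ∀ k, u k ∈ subdifferential θ z := fun k => by
    simpa using hball' k 0 (zero_mem _) (by simpa using mul_pos (ht0 k) hr)
  refine ⟨hv, fun k => WithLp.toLp 2 (z, u k), fun _ => WithLp.toLp 2 (y, -0), ?_,
    tendsto_const_nhds, fun k => ⟨huk k, mem_regularNormalCone_of_inner_nonpos ?_⟩⟩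
  · refine ((WithLp.prod_continuous_toLp 2 E E).tendsto (z, v)).comp
      (tendsto_const_nhds.prodMk_nhds ?_)
    simpa using (tendsto_const_nhds (x := v)).add (htlim.smul_const (c - v))
  · have hf : Tendsto (fun q : WithLp 2 (E × E) => q.fst) (𝓝 (WithLp.toLp 2 (z, u k))) (𝓝 z) :=
      (WithLp.continuous_fst 2 E E).tendsto _
    have hs : Tendsto (fun q : WithLp 2 (E × E) => q.snd) (𝓝 (WithLp.toLp 2 (z, u k)))
        (𝓝 (u k)) := (WithLp.continuous_snd 2 E E).tendsto _
    -- Half of the radius is for `q.snd - u k`, half for the shift `ε • y`.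
    have hρ : 0 < t k * r / 2 := by have := mul_pos (ht0 k) hr; positivity
    filter_upwards [eventually_mem_nhdsWithin, nhdsWithin_le_nhds
      (hf.eventually (hθ.eventually_subdifferential_subset hz)),
      nhdsWithin_le_nhds (hs.eventually (Metric.ball_mem_nhds _ hρ))] with q hq hq1 hq2
    obtain ⟨hqz, heq⟩ := hq1 q.snd hq
    obtain ⟨ε, hε, hεy⟩ : ∃ ε : ℝ, 0 < ε ∧ ‖ε • y‖ < t k * r / 2 := by
      refine ⟨t k * r / 2 / (‖y‖ + 1), by positivity, ?_⟩
      rw [norm_smul, Real.norm_eq_abs, abs_of_pos (by positivity), div_mul_eq_mul_div,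
        div_lt_iff₀ (by positivity)]
      nlinarith [norm_nonneg y]
    have hmem : q.snd + ε • y ∈ subdifferential θ z := by
      have hd : q.snd - u k + ε • y ∈ parallelSubspace θ z :=
        add_mem (AffineSubspace.vsub_mem_direction (subset_affineSpan ℝ _ hqz)
          (subset_affineSpan ℝ _ (huk k))) (Submodule.smul_mem _ _ hy)
      have := hball' k _ hd ?_
      · convert this using 1; abel
      · have h3 : ‖q.snd - u k‖ < t k * r / 2 := by simpa [dist_eq_norm] using hq2
        linarith [norm_add_le (q.snd - u k) (ε • y)]
    -- By `heq`, the inequality of the subgradient `q.snd` at `z` is an equality at `q.fst`;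
    -- comparison with the shifted subgradient isolates the term in `ε • y`.
    have h4 := (hθ.mem_subdifferential.1 hmem).2 q.fst (hθ.mem_subdifferential.1 hq).1
    rw [heq, inner_add_left, inner_smul_left] at h4
    have h5 : ε * inner ℝ y (q.fst - z) ≤ ε * 0 := by
      simp only [conj_trivial] at h4
      linarith
    have h6 := le_of_mul_le_mul_left h5 hε
    simpa [WithLp.prod_inner_apply] using h6

end PiecewiseLinear

end VarAnalysis

namespace VarAnalysis

/-! ### Multipliers for normals to preimages of closed convex sets. -/

section Preimages

variable {E F : Type*} [NormedAddCommGroup E] [InnerProductSpace ℝ E]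
  [NormedAddCommGroup F] [InnerProductSpace ℝ F]

theorem norm_le_of_forall_neg_le_inner {g : E} {c : ℝ} (hc : 0 ≤ c)
    (h : ∀ y, -(c * ‖y‖) ≤ inner ℝ g y) : ‖g‖ ≤ c := by
  have h1 := h (-g)
  rw [inner_neg_right, real_inner_self_eq_norm_sq, norm_neg] at h1
  nlinarith [norm_nonneg g]

/-- First-order lower bounds for increments are inherited by the derivative. -/
theorem neg_le_apply_of_eventually {φ : E → ℝ} {φ' : E →L[ℝ] ℝ} {y : E} {c : ℝ}
    (hφ : HasFDerivAt φ φ' y) (h : ∀ᶠ y' in 𝓝 y, φ y - c * ‖y' - y‖ ≤ φ y') (u : E) :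
    -(c * ‖u‖) ≤ φ' u := by
  have hline : HasDerivAt (fun t : ℝ => y + t • u) u 0 := by
    simpa using ((hasDerivAt_id (0 : ℝ)).smul_const u).const_add y
  have hφ0 : HasFDerivAt φ φ' (y + (0 : ℝ) • u) := by simpa using hφ
  have hd : HasDerivAt (fun t : ℝ => φ (y + t • u)) (φ' u) 0 := hφ0.comp_hasDerivAt 0 hline
  have hs := hd.tendsto_slope_zero_right
  simp only [zero_add, zero_smul, add_zero, smul_eq_mul] at hs
  refine ge_of_tendsto hs ?_
  have hlim : Tendsto (fun t : ℝ => y + t • u) (𝓝[>] 0) (𝓝 y) := by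
    have : Tendsto (fun t : ℝ => y + t • u) (𝓝 0) (𝓝 (y + (0 : ℝ) • u)) := by
      apply Continuous.tendsto; fun_prop
    simpa using this.mono_left nhdsWithin_le_nhds
  filter_upwards [hlim.eventually h, eventually_mem_nhdsWithin] with t ht ht0
  have ht0 : 0 < t := ht0
  rw [add_sub_cancel_left, norm_smul, Real.norm_eq_abs, abs_of_pos ht0] at ht
  rw [le_inv_mul_iff₀ ht0]
  linarith

/-- Minimality of the distance to a convex set near a point is a normal cone condition. -/
theorem inner_nonpos_of_norm_le_of_convex {C : Set F} (hC : Convex ℝ C) {g u : F} {r : ℝ}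
    (hu : u ∈ C) (hr : 0 < r) (h : ∀ u' ∈ C, ‖u' - u‖ < r → ‖g - u‖ ≤ ‖g - u'‖) :
    ∀ u' ∈ C, inner ℝ (g - u) (u' - u) ≤ 0 := by
  intro u' hu'
  have h1 : HasDerivAt (fun t : ℝ => g - (u + t • (u' - u))) (-(u' - u)) 0 := by
    simpa using (((hasDerivAt_id (0 : ℝ)).smul_const (u' - u)).const_add u).const_sub g
  have hd := h1.norm_sq.tendsto_slope_zero_right
  simp only [zero_add, zero_smul, add_zero, smul_eq_mul, inner_neg_right, mul_neg] at hd
  have : 0 ≤ -(2 * inner ℝ (g - u) (u' - u)) := by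
    refine ge_of_tendsto hd ?_
    have hlim : Tendsto (fun t : ℝ => ‖t • (u' - u)‖) (𝓝[>] 0) (𝓝 0) := by
      have : Tendsto (fun t : ℝ => ‖t • (u' - u)‖) (𝓝 0) (𝓝 ‖(0 : ℝ) • (u' - u)‖) := by
        apply Continuous.tendsto; fun_prop
      simpa using this.mono_left nhdsWithin_le_nhds
    filter_upwards [hlim.eventually_lt_const hr, Ioc_mem_nhdsGT (zero_lt_one' ℝ)] with t ht ht1
    have := h _ (hC.add_smul_sub_mem hu hu' ⟨ht1.1.le, ht1.2⟩) (by simpa using ht)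
    refine mul_nonneg (inv_nonneg.2 ht1.1.le) (sub_nonneg.2 ?_)
    gcongr
  linarith

variable [FiniteDimensional ℝ E] [FiniteDimensional ℝ F]

/-- Fuzzy multiplier rule for regular normals to the preimage of a closed convex set. -/
theorem exists_fuzzy_multiplier {C : Set F} (hC : Convex ℝ C) (hCc : IsClosed C) {G : E → F}
    {x η : E} (hG : ∀ᶠ y in 𝓝 x, DifferentiableAt ℝ G y) (hx : G x ∈ C)
    (hη : η ∈ regularNormalCone (G ⁻¹' C) x) {δ : ℝ} (hδ : 0 < δ) :
    ∃ y u μ, ‖y - x‖ < δ ∧ ‖u - G x‖ < δ ∧ u ∈ C ∧ (∀ u' ∈ C, inner ℝ μ (u' - u) ≤ 0) ∧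
      ‖(fderiv ℝ G y).adjoint μ - η‖ ≤ δ := by
  set ε := δ / 2 with hε
  have hε0 : 0 < ε := by positivity
  -- The tolerance `ε / 2` is strictly below the weight `ε` of `‖y - x‖` in the penalized objective;
  -- this gap forces the minimizers to converge to `x`.
  have hloc : ∀ᶠ y in 𝓝 x, DifferentiableAt ℝ G y ∧
      (y ∈ G ⁻¹' C → inner ℝ η (y - x) ≤ ε / 2 * ‖y - x‖) :=
    hG.and (eventually_nhdsWithin_iff.1 (hη (ε / 2) (by positivity)))
  obtain ⟨R, hR, hball⟩ := Metric.eventually_nhds_iff.1 hloc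
  obtain ⟨ρ, hρ0, hρR, hρδ⟩ : ∃ ρ, 0 < ρ ∧ ρ < R ∧ ρ < δ :=
    ⟨min R δ / 2, by positivity, by linarith [min_le_left R δ, lt_min hR hδ],
      by linarith [min_le_right R δ, lt_min hR hδ]⟩
  have hballρ : ∀ y ∈ Metric.closedBall x ρ, DifferentiableAt ℝ G y ∧
      (y ∈ G ⁻¹' C → inner ℝ η (y - x) ≤ ε / 2 * ‖y - x‖) := fun y hy =>
    hball (lt_of_le_of_lt hy hρR)
  set K : Set (E × F) := Metric.closedBall x ρ ×ˢ (C ∩ Metric.closedBall (G x) ρ) with hK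
  have hKc : IsCompact K :=
    (isCompact_closedBall x ρ).prod ((isCompact_closedBall (G x) ρ).inter_left hCc)
  have hxK : (x, G x) ∈ K :=
    ⟨Metric.mem_closedBall_self hρ0.le, hx, Metric.mem_closedBall_self hρ0.le⟩
  have hGc : ContinuousOn (fun q : E × F => G q.1) K := by
    have : ContinuousOn G (Metric.closedBall x ρ) := fun y hy =>
      (hballρ y hy).1.continuousAt.continuousWithinAt
    exact this.comp continuousOn_fst fun q hq => hq.1
  -- Quadratic penalty for `G y = u`, with `u ∈ C` as a separate variable. The objective vanishes at
  -- `(x, G x)`, so its minima are nonpositive.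
  set f : ℕ → E × F → ℝ := fun k q =>
    k * ‖G q.1 - q.2‖ ^ 2 - inner ℝ η (q.1 - x) + ε * ‖q.1 - x‖ with hf
  have hfc : ∀ k, ContinuousOn (f k) K := fun k => by
    refine ContinuousOn.add (ContinuousOn.sub (continuousOn_const.mul
      ((hGc.sub continuousOn_snd).norm.pow 2)) ?_) ?_ <;> fun_prop
  choose q hqK hqmin using fun k => hKc.exists_isMinOn ⟨_, hxK⟩ (hfc k)
  have hle : ∀ k, f k (q k) ≤ 0 := fun k => by
    simpa [hf] using hqmin k hxK
  obtain ⟨q₀, hq₀K, σ, hσ, hqσ⟩ := hKc.tendsto_subseq hqK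
  have hbdd : ∀ k : ℕ, (k : ℝ) * ‖G (q k).1 - (q k).2‖ ^ 2 ≤ ‖η‖ * ρ := fun k => by
    have h1 := hle k
    have h2 : ‖(q k).1 - x‖ ≤ ρ := by simpa [dist_eq_norm] using (hqK k).1
    have h3 : inner ℝ η ((q k).1 - x) ≤ ‖η‖ * ρ :=
      (real_inner_le_norm _ _).trans (by gcongr)
    have h4 : 0 ≤ ε * ‖(q k).1 - x‖ := by positivity
    simp only [hf] at h1
    linarith
  have hqσ' : Tendsto (q ∘ σ) atTop (𝓝[K] q₀) :=
    tendsto_nhdsWithin_iff.2 ⟨hqσ, Eventually.of_forall fun k => hqK _⟩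
  have hGlim : Tendsto (fun k => ‖G (q (σ k)).1 - (q (σ k)).2‖ ^ 2) atTop
      (𝓝 (‖G q₀.1 - q₀.2‖ ^ 2)) :=
    (((hGc.sub continuousOn_snd).norm.pow 2) q₀ hq₀K).tendsto.comp hqσ'
  have hG0 : ‖G q₀.1 - q₀.2‖ ^ 2 ≤ 0 := by
    have h1 : Tendsto (fun k => ‖η‖ * ρ / (σ k : ℝ)) atTop (𝓝 0) :=
      tendsto_const_nhds.div_atTop (tendsto_natCast_atTop_atTop.comp hσ.tendsto_atTop)
    refine le_of_tendsto_of_tendsto hGlim h1 ?_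
    filter_upwards [hσ.tendsto_atTop.eventually_gt_atTop 0] with k hk
    rw [le_div_iff₀ (by exact_mod_cast hk), mul_comm]
    exact hbdd _
  have hGq : G q₀.1 = q₀.2 := by
    rw [← sub_eq_zero, ← norm_eq_zero]
    exact pow_eq_zero_iff two_ne_zero |>.1 (le_antisymm hG0 (by positivity))
  have hq₀x : q₀.1 = x := by
    have h1 : -inner ℝ η (q₀.1 - x) + ε * ‖q₀.1 - x‖ ≤ 0 := by
      have hc : Continuous fun q : E × F => -inner ℝ η (q.1 - x) + ε * ‖q.1 - x‖ := by fun_prop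
      refine le_of_tendsto' ((hc.tendsto q₀).comp hqσ) fun k => ?_
      have h2 := hle (σ k)
      have h3 : 0 ≤ (σ k : ℝ) * ‖G (q (σ k)).1 - (q (σ k)).2‖ ^ 2 := by positivity
      simp only [hf] at h2
      simp only [Function.comp]
      linarith
    have h2 := (hballρ _ hq₀K.1).2 (by rw [Set.mem_preimage, hGq]; exact hq₀K.2.1)
    rw [← sub_eq_zero, ← norm_eq_zero]
    refine le_antisymm ?_ (norm_nonneg _)
    nlinarith
  -- Late minimizers lie inside both balls, so the ball constraints do not affect the optimality
  -- conditions.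
  have hev : ∀ᶠ p : E × F in 𝓝 q₀, ‖p.1 - x‖ < ρ ∧ ‖p.2 - G x‖ < ρ := by
    have hc : Continuous fun p : E × F => ‖p.1 - x‖ := by fun_prop
    have hc' : Continuous fun p : E × F => ‖p.2 - G x‖ := by fun_prop
    refine ((hc.tendsto q₀).eventually_lt_const ?_).and
      ((hc'.tendsto q₀).eventually_lt_const ?_)
    · simpa [hq₀x] using hρ0
    · simpa [← hGq, hq₀x] using hρ0
  obtain ⟨k, ⟨hk1, hk2⟩, hk0⟩ :=
    ((hqσ.eventually hev).and (hσ.tendsto_atTop.eventually_gt_atTop 0)).exists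
  simp only [Function.comp] at hk1 hk2
  set j := σ k with hj
  have hj0 : (0 : ℝ) < j := by exact_mod_cast hk0
  set y := (q j).1 with hy
  set u := (q j).2 with hu
  have huC : u ∈ C := (hqK j).2.1
  have hyK : y ∈ Metric.closedBall x ρ := (hqK j).1
  have hmin : ∀ y' u', ‖y' - x‖ ≤ ρ → u' ∈ C → ‖u' - G x‖ ≤ ρ → f j (y, u) ≤ f j (y', u') := by
    intro y' u' h1 h2 h3
    exact hqmin j (show (y', u') ∈ K from
      ⟨by simpa [dist_eq_norm] using h1, h2, by simpa [dist_eq_norm] using h3⟩)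
  have hnormal : ∀ u' ∈ C, inner ℝ (G y - u) (u' - u) ≤ 0 := by
    refine inner_nonpos_of_norm_le_of_convex hC huC (sub_pos.2 hk2) fun u' hu' hlt => ?_
    have h1 := hmin y u' hk1.le hu' (by
      have := norm_add_le (u' - u) (u - G x)
      rw [sub_add_sub_cancel] at this
      linarith)
    simp only [hf] at h1
    have h2 : ‖G y - u‖ ^ 2 ≤ ‖G y - u'‖ ^ 2 := le_of_mul_le_mul_left (by linarith) hj0
    exact le_of_sq_le_sq h2 (norm_nonneg _)
  -- The multiplier is the gradient of the penalty `j * ‖·‖ ^ 2` at `G y - u`. Optimality in `u`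
  -- makes it normal to `C`; optimality in `y` gives the adjoint estimate, with error `ε` from the
  -- term `ε * ‖y - x‖`.
  refine ⟨y, u, (2 * (j : ℝ)) • (G y - u), hk1.trans hρδ, hk2.trans hρδ, huC, fun u' hu' => ?_, ?_⟩
  · rw [inner_smul_left]
    exact mul_nonpos_of_nonneg_of_nonpos (by simp) (hnormal u' hu')
  · have hGd := (hballρ y hyK).1.hasFDerivAt
    have hφ := (((hGd.sub_const u).norm_sq.const_mul (j : ℝ)).sub
      (((innerSL ℝ η).hasFDerivAt (x := y - x)).comp y ((hasFDerivAt_id y).sub_const x)))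
    have hbound := neg_le_apply_of_eventually (c := ε) hφ ?_
    · refine (norm_le_of_forall_neg_le_inner hε0.le fun w => (hbound w).trans_eq ?_).trans
        (by linarith)
      simp [inner_sub_left, ContinuousLinearMap.adjoint_inner_left, inner_smul_left]
      ring
    · have hc : Continuous fun y' : E => ‖y' - x‖ := by fun_prop
      filter_upwards [(hc.tendsto y).eventually_lt_const hk1] with y' hy'
      have h1 := hmin y' u hy'.le huC hk2.le
      have h2 : ‖y' - x‖ ≤ ‖y - x‖ + ‖y' - y‖ := by
        rw [add_comm, ← sub_add_sub_cancel y' y x]; exact norm_add_le _ _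
      have h3 := mul_le_mul_of_nonneg_left h2 hε0.le
      simp only [hf] at h1
      simp
      linarith

/-- Normals to the preimage of a closed convex set under a `C¹` mapping have multipliers, under
the basic constraint qualification. -/
theorem exists_multiplier_of_mem_normalCone_preimage {C : Set F} (hC : Convex ℝ C)
    (hCc : IsClosed C) {G : E → F} {x η : E} (hG : ContDiffAt ℝ 1 G x)
    (hq : ∀ μ ∈ normalCone C (G x), (fderiv ℝ G x).adjoint μ = 0 → μ = 0)
    (hη : η ∈ normalCone (G ⁻¹' C) x) :
    ∃ μ ∈ normalCone C (G x), (fderiv ℝ G x).adjoint μ = η := by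
  obtain ⟨hx, xs, ηs, hxs, hηs, h⟩ := hη
  have hdiff : ∀ᶠ y in 𝓝 x, ∀ᶠ y' in 𝓝 y, DifferentiableAt ℝ G y' := by
    refine eventually_eventually_nhds.2 ((hG.eventually (by simp)).mono fun y hy => ?_)
    exact hy.differentiableAt one_ne_zero
  obtain ⟨N, hN⟩ := eventually_atTop.1 (hxs.eventually hdiff)
  have hδ : ∀ k : ℕ, (0 : ℝ) < 1 / (k + 1) := fun k => by positivity
  choose y u μ hy hu huC hμ hμη using fun k : ℕ =>
    exists_fuzzy_multiplier hC hCc (hN (N + k) (by omega)) (h (N + k)).1 (h (N + k)).2 (hδ k)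
  have hδlim : Tendsto (fun k : ℕ => (1 : ℝ) / (k + 1)) atTop (𝓝 0) :=
    tendsto_one_div_add_atTop_nhds_zero_nat
  have hshift : Tendsto (fun k : ℕ => N + k) atTop atTop :=
    tendsto_atTop_mono (fun k => Nat.le_add_left k N) tendsto_id
  have hylim : Tendsto y atTop (𝓝 x) := by
    have h1 : Tendsto (fun k => y k - xs (N + k)) atTop (𝓝 0) :=
      squeeze_zero_norm (fun k => (hy k).le) hδlim
    simpa using h1.add (hxs.comp hshift)
  have hulim : Tendsto u atTop (𝓝 (G x)) := by
    have h1 : Tendsto (fun k => u k - G (xs (N + k))) atTop (𝓝 0) :=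
      squeeze_zero_norm (fun k => (hu k).le) hδlim
    simpa using h1.add ((hG.continuousAt.tendsto.comp hxs).comp hshift)
  have hAlim : Tendsto (fun k => (fderiv ℝ G (y k)).adjoint (μ k)) atTop (𝓝 η) := by
    have h1 : Tendsto (fun k => (fderiv ℝ G (y k)).adjoint (μ k) - ηs (N + k)) atTop (𝓝 0) :=
      squeeze_zero_norm (fun k => hμη k) hδlim
    simpa using h1.add (hηs.comp hshift)
  have hDlim : Tendsto (fun k => (fderiv ℝ G (y k)).adjoint) atTop (𝓝 (fderiv ℝ G x).adjoint) :=
    (ContinuousLinearMap.adjoint.continuous.tendsto _).comp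
      ((hG.continuousAt_fderiv one_ne_zero).tendsto.comp hylim)
  -- Used twice: with `c k = ‖μ (σ k)‖⁻¹` for unbounded multipliers and with `c k = 1` along a
  -- bounded subsequence.
  have hlimit : ∀ (σ : ℕ → ℕ) (c : ℕ → ℝ) (ν : F), Tendsto σ atTop atTop → (∀ k, 0 ≤ c k) →
      Tendsto (fun k => c k • μ (σ k)) atTop (𝓝 ν) → ν ∈ normalCone C (G x) ∧
        Tendsto (fun k => c k • (fderiv ℝ G (y (σ k))).adjoint (μ (σ k))) atTop
          (𝓝 ((fderiv ℝ G x).adjoint ν)) := by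
    intro σ c ν hσ hc hν
    constructor
    · refine (mem_normalCone_iff_of_convex hC).2 ⟨hx, fun u' hu' => ?_⟩
      refine le_of_tendsto' (hν.inner (tendsto_const_nhds.sub (hulim.comp hσ))) fun k => ?_
      rw [inner_smul_left]
      exact mul_nonpos_of_nonneg_of_nonpos (by simpa using hc k) (hμ _ u' hu')
    · simpa [Function.comp_def] using
        ((isBoundedBilinearMap_apply (𝕜 := ℝ) (E := F) (F := E)).continuous.tendsto
          ((fderiv ℝ G x).adjoint, ν)).comp ((hDlim.comp hσ).prodMk_nhds hν)
  by_cases hunb : Tendsto (fun k => ‖μ k‖) atTop atTop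
  · exfalso
    have hsphere : ∀ᶠ k in atTop, ‖μ k‖⁻¹ • μ k ∈ Metric.sphere (0 : F) 1 := by
      filter_upwards [hunb.eventually_gt_atTop 0] with k hk
      simp [norm_smul, hk.ne']
    obtain ⟨ν, hν, σ, hσ, hlim⟩ := (isCompact_sphere (0 : F) 1).tendsto_subseq' hsphere.frequently
    obtain ⟨h1, h2⟩ := hlimit σ _ ν hσ.tendsto_atTop (fun k => by positivity) hlim
    -- The adjoint images converge, so normalization sends them to zero; the unit limit `ν` would
    -- violate the qualification condition.
    have h3 : Tendsto (fun k => ‖μ (σ k)‖⁻¹ • (fderiv ℝ G (y (σ k))).adjoint (μ (σ k))) atTop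
        (𝓝 ((0 : ℝ) • η)) :=
      (tendsto_inv_atTop_zero.comp (hunb.comp hσ.tendsto_atTop)).smul
        (hAlim.comp hσ.tendsto_atTop)
    rw [zero_smul] at h3
    have h4 := hq ν h1 (tendsto_nhds_unique h2 h3)
    simp [h4] at hν
  · rw [tendsto_atTop] at hunb
    push Not at hunb
    obtain ⟨B, hB⟩ := hunb
    have hfreq : ∃ᶠ k in atTop, μ k ∈ Metric.closedBall (0 : F) B :=
      hB.mono fun k hk => by simpa using hk.le
    obtain ⟨ν, -, σ, hσ, hlim⟩ := (isCompact_closedBall (0 : F) B).tendsto_subseq' hfreq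
    obtain ⟨h1, h2⟩ := hlimit σ (fun _ => 1) ν hσ.tendsto_atTop (fun _ => zero_le_one)
      (by simpa [Function.comp_def] using hlim)
    simp only [one_smul] at h2
    exact ⟨ν, h1, tendsto_nhds_unique h2 (hAlim.comp hσ.tendsto_atTop)⟩

end Preimages

end VarAnalysis

namespace VarAnalysis

/-! ### Chain rule through epigraphs. -/

section EpiMap

variable {E F : Type*} [NormedAddCommGroup E] [InnerProductSpace ℝ E]
  [NormedAddCommGroup F] [InnerProductSpace ℝ F]

/-- The mapping `(x, r) ↦ (f x, r)`, which pulls epigraphs back to epigraphs of compositions. -/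
def epiMap (f : E → F) (q : WithLp 2 (E × ℝ)) : WithLp 2 (F × ℝ) := WithLp.toLp 2 (f q.fst, q.snd)

theorem contDiffAt_epiMap {f : E → F} {q : WithLp 2 (E × ℝ)} (hf : ContDiffAt ℝ 1 f q.fst) :
    ContDiffAt ℝ 1 (epiMap f) q :=
  WithLp.contDiff_toLp.contDiffAt.comp q
    ((hf.comp q (WithLp.fstL 2 ℝ E ℝ).contDiff.contDiffAt).prodMk
      (WithLp.sndL 2 ℝ E ℝ).contDiff.contDiffAt)

theorem fderiv_epiMap {f : E → F} {q : WithLp 2 (E × ℝ)} (hf : DifferentiableAt ℝ f q.fst)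
    (y : WithLp 2 (E × ℝ)) :
    fderiv ℝ (epiMap f) q y = WithLp.toLp 2 (fderiv ℝ f q.fst y.fst, y.snd) := by
  have h1 : HasFDerivAt (fun q : WithLp 2 (E × ℝ) => (f q.fst, q.snd))
      (((fderiv ℝ f q.fst).comp (WithLp.fstL 2 ℝ E ℝ)).prod (WithLp.sndL 2 ℝ E ℝ)) q :=
    (HasFDerivAt.comp q hf.hasFDerivAt (WithLp.fstL 2 ℝ E ℝ).hasFDerivAt).prodMk
      (WithLp.sndL 2 ℝ E ℝ).hasFDerivAt
  have h2 : HasFDerivAt (epiMap f) _ q :=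
    HasFDerivAt.comp q (WithLp.prodContinuousLinearEquiv 2 ℝ F ℝ).symm.hasFDerivAt h1
  rw [h2.fderiv]
  rfl

theorem adjoint_fderiv_epiMap [CompleteSpace E] [CompleteSpace F] {f : E → F} {q : WithLp 2 (E × ℝ)}
    (hf : DifferentiableAt ℝ f q.fst) (μ : WithLp 2 (F × ℝ)) :
    (fderiv ℝ (epiMap f) q).adjoint μ =
      WithLp.toLp 2 ((fderiv ℝ f q.fst).adjoint μ.fst, μ.snd) := by
  refine ext_inner_left ℝ fun y => ?_
  rw [ContinuousLinearMap.adjoint_inner_right, fderiv_epiMap hf, WithLp.prod_inner_apply,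
    WithLp.prod_inner_apply]
  congr 1
  exact (ContinuousLinearMap.adjoint_inner_right _ _ _).symm

end EpiMap

section Composition

variable {n d m l p : ℕ} [NeZero l]

/-- First-order chain rule: partial subgradients of the composition have multipliers. -/
theorem multipliers_nonempty {θ : EuclideanSpace ℝ (Fin m) → WithTop ℝ}
    {a : Fin l → EuclideanSpace ℝ (Fin m)} {α : Fin l → ℝ}
    {b : Fin p → EuclideanSpace ℝ (Fin m)} {β : Fin p → ℝ} (hθ : IsCPWLRepr θ a α b β)
    {Φ : EuclideanSpace ℝ (Fin n) × EuclideanSpace ℝ (Fin d) → EuclideanSpace ℝ (Fin m)}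
    {x : EuclideanSpace ℝ (Fin n)} {w : EuclideanSpace ℝ (Fin d)}
    (hψ : IsFullyAmenable θ Φ x w) {q : EuclideanSpace ℝ (Fin n)}
    (hq : q ∈ partialSubdifferential (fun y => θ (Φ y)) x w) :
    (multipliers θ Φ x w q).Nonempty := by
  obtain ⟨r, hr, hN⟩ := hq
  set A := fderiv ℝ (fun x' => Φ (x', w)) x
  set P : WithLp 2 (EuclideanSpace ℝ (Fin n) × ℝ) := WithLp.toLp 2 (x, r)
  set G : WithLp 2 (EuclideanSpace ℝ (Fin n) × ℝ) → WithLp 2 (EuclideanSpace ℝ (Fin m) × ℝ) :=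
    epiMap (fun x' => Φ (x', w))
  have hΦ : ContDiffAt ℝ 1 (fun x' => Φ (x', w)) x :=
    (hψ.smooth.of_le one_le_two).comp x (by fun_prop : ContDiffAt ℝ 1 (fun x' => (x', w)) x)
  have hGc : ContDiffAt ℝ 1 G P := contDiffAt_epiMap hΦ
  have hadj : ∀ μ, (fderiv ℝ G P).adjoint μ = WithLp.toLp 2 (A.adjoint μ.fst, μ.snd) :=
    adjoint_fderiv_epiMap (hΦ.differentiableAt one_ne_zero)
  -- The adjoint keeps the last coordinate, so a normal in its kernel is horizontal and its first
  -- component is a singular subgradient.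
  have hqual : ∀ μ ∈ normalCone (epi θ) (G P), (fderiv ℝ G P).adjoint μ = 0 → μ = 0 := by
    intro μ hμ h0
    rw [hadj] at h0
    have h1 : A.adjoint μ.fst = 0 := congrArg WithLp.fst h0
    have h2 : μ.snd = 0 := congrArg WithLp.snd h0
    have h3 : μ.fst ∈ singularSubdifferential θ (Φ (x, w)) ∩ kerAdjoint Φ x w := by
      refine ⟨⟨r, hr, ?_⟩, h1⟩
      rw [← h2]
      exact hμ
    rw [hψ.qualification] at h3
    have h4 : μ.fst = 0 := h3
    calc μ = WithLp.toLp 2 (μ.fst, μ.snd) := rfl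
      _ = 0 := by rw [h4, h2]; rfl
  -- `hN` applies as it stands: the epigraph of the composition is the preimage `G ⁻¹' epi θ` by
  -- definition.
  obtain ⟨μ, hμ, hμq⟩ := exists_multiplier_of_mem_normalCone_preimage hθ.convex_epi
    hθ.isClosed_epi hGc hqual hN
  rw [hadj] at hμq
  have h1 : A.adjoint μ.fst = q := congrArg WithLp.fst hμq
  have h2 : μ.snd = -1 := congrArg WithLp.snd hμq
  refine ⟨μ.fst, ⟨r, hr, ?_⟩, h1⟩
  rw [← h2]
  exact hμ

end Composition

end VarAnalysis

/-! ### Assembly of the inclusions and the qualification condition. -/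

theorem mainTheorem5 {n d m l p : ℕ} [NeZero l]
    (θ : EuclideanSpace ℝ (Fin m) → WithTop ℝ)
    (a : Fin l → EuclideanSpace ℝ (Fin m)) (α : Fin l → ℝ)
    (b : Fin p → EuclideanSpace ℝ (Fin m)) (β : Fin p → ℝ)
    (hθ : VarAnalysis.IsCPWLRepr θ a α b β)
    (Φ : EuclideanSpace ℝ (Fin n) × EuclideanSpace ℝ (Fin d) → EuclideanSpace ℝ (Fin m))
    (x : EuclideanSpace ℝ (Fin n)) (w : EuclideanSpace ℝ (Fin d))
    (z : EuclideanSpace ℝ (Fin m)) (hz : z = Φ (x, w))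
    (hψ : VarAnalysis.IsFullyAmenable θ Φ x w) :
    -- (i)
    (∀ v ∈ VarAnalysis.subdifferential θ z,
      VarAnalysis.secondSubdifferential θ z v 0 =
        ((Submodule.span ℝ {y | ∃ i ∈ VarAnalysis.activeK θ a α z,
              ∃ j ∈ VarAnalysis.activeK θ a α z, y = a i - a j} ⊔
          Submodule.span ℝ {y | ∃ i ∈ VarAnalysis.activeI b β z, y = b i} :
            Submodule ℝ (EuclideanSpace ℝ (Fin m))) : Set (EuclideanSpace ℝ (Fin m)))) ∧
    -- (ii)
    (∀ v ∈ VarAnalysis.subdifferential θ z,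
      VarAnalysis.secondSubdifferential θ z v 0 =
        (VarAnalysis.parallelSubspace θ z : Set (EuclideanSpace ℝ (Fin m)))) ∧
    -- (iii)
    (∀ q ∈ VarAnalysis.partialSubdifferential (fun y => θ (Φ y)) x w,
      (VarAnalysis.SOQC θ Φ x w q ↔
        (VarAnalysis.parallelSubspace θ z : Set (EuclideanSpace ℝ (Fin m))) ∩
          VarAnalysis.kerAdjoint Φ x w = {0})) ∧
    (∀ v ∈ VarAnalysis.subdifferential θ z,
      (VarAnalysis.secondSubdifferential θ z v 0 ∩ VarAnalysis.kerAdjoint Φ x w = {0} ↔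
        (VarAnalysis.parallelSubspace θ z : Set (EuclideanSpace ℝ (Fin m))) ∩
          VarAnalysis.kerAdjoint Φ x w = {0})) := by
  have hle : VarAnalysis.activeSpan θ a α b β z ≤ VarAnalysis.parallelSubspace θ z := by
    subst hz
    exact hθ.activeSpan_le_parallelSubspace (hθ.mem_effDom.1 hψ.mem_dom)
  have hii : ∀ v ∈ VarAnalysis.subdifferential θ z,
      VarAnalysis.secondSubdifferential θ z v 0 = (VarAnalysis.parallelSubspace θ z : Set _) :=
    fun v hv => Set.Subset.antisymm (hθ.secondSubdifferential_zero_subset.trans hle)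
      (hθ.parallelSubspace_subset_secondSubdifferential hv)
  refine ⟨fun v hv => Set.Subset.antisymm hθ.secondSubdifferential_zero_subset ?_, hii,
    fun q hq => ⟨fun h => ?_, fun h v hv => ?_⟩, fun v hv => by
      rw [hii v hv]⟩
  · rw [hii v hv]
    exact hle
  -- Without a multiplier `SOQC` would hold vacuously and carry no information about the parallel
  -- subspace.
  · obtain ⟨v, hv⟩ := VarAnalysis.multipliers_nonempty hθ hψ hq
    rw [← hii v (hz ▸ hv.1), hz]
    exact h v hv
  · rw [← hz, hii v (hz ▸ hv.1)]
    exact h
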